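/- Let $Z=(z_0,\dots,z_n)$ be homogeneous coordinates on $\mathbb{CP}^n$, and let $\Lambda=(\Lambda^{\alpha\beta})$ be a non-zero skew-symmetric matrix of quadratic forms in $Z$ such that the bracket $\{f,g\}=\sum_{\alpha,\beta}\Lambda^{\alpha\beta}\,\partial_\alpha f\,\partial_\beta g$ satisfies the Jacobi identity. Assume also that for every $k\ge 0$ (summing over repeated indices) $$\bigl(\overleftarrow{\partial_{\alpha_1}}\Lambda^{\alpha_1\beta_1}\overrightarrow{\partial_{\beta_1}}\bigr)\cdots\bigl(\overleftarrow{\partial_{\alpha_k}}\Lambda^{\alpha_k\beta_k}\overrightarrow{\partial_{\beta_k}}\bigr)=\overleftarrow{\partial_{\alpha_1\cdots\alpha_k}}\,\Lambda^{\alpha_1\beta_1}\cdots\Lambda^{\alpha_k\beta_k}\,\overrightarrow{\partial_{\beta_1\cdots\beta_k}},$$ where on the left-hand side each arrow differentiates everything that stands on its side. For $\tau\in\mathbb C$ let $\star_\tau$ be the star product obtained by quantizing $\tau\Lambda$, $$f\star_\tau g=\sum_{k\ge 0}\frac{1}{k!}\Bigl(\frac{\mu}{2}\Bigr)^k\tau^k\,\Lambda^{\alpha_1\beta_1}\cdots\Lambda^{\alpha_k\beta_k}\,\partial_{\alpha_1}\cdots\partial_{\alpha_k}f\;\partial_{\beta_1}\cdots\partial_{\beta_k}g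 ,$$ on $\mathbb C[Z][\mu,\mu^{-1}]$, extended to formal sums $\sum_{d\ge0}F_d$ with $F_d\in\mathbb C[Z]_d[\mu,\mu^{-1}]$. For a complex symmetric matrix $A$ put $A[Z]=ZA\,{}^tZ$ and $$e_{\star_\tau}^{\frac1\mu A[Z]}=\sum_{m\ge0}\frac1{m!}\,\underbrace{\tfrac1\mu A[Z]\star_\tau\cdots\star_\tau\tfrac1\mu A[Z]}_{m}.$$ Regard a formal sum as an element of the space $\prod_{d\ge0}H^0(\mathbb{CP}^n,\mathcal O(d)[\mu,\mu^{-1}]])$ of formal sums of sheaf cohomology classes, through the global sections of $\mathcal O(d)[\mu,\mu^{-1}]]$ defined by its components $F_d$. Here $[\mu,\mu^{-1}]]$ means Laurent series in $\mu^{-1}$. Then different values of $\tau$ are detected in this space through the star exponentials: 1. There are complex symmetric matrices $A,B$, depending only on $\Lambda$, such that for all $\tau,\tau'\in\mathbb C$ with $\tau\ne\tau'$ the elements $e_{\star_\tau}^{\frac1\mu A[Z]}\star_\tau e_{\star_\tau}^{\frac1\mu B[Z]}$ and $e_{\star_{\tau'}}^{\frac1\mu A[Z]}\star_{\tau'} e_{\star_{\tau'}}^{\frac1\mu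 B[Z]}$ are different. 2. Single star exponentials detect $\tau$ up to sign: there is a complex symmetric matrix $A$, depending only on $\Lambda$, such that for all $\tau,\tau'\in\mathbb C$ with $\tau\ne\pm\tau'$ the elements $e_{\star_\tau}^{\frac1\mu A[Z]}$ and $e_{\star_{\tau'}}^{\frac1\mu A[Z]}$ are different. 3. The sign of $\tau$ cannot be detected by single star exponentials: $e_{\star_{-\tau}}^{\frac1\mu A[Z]}=e_{\star_\tau}^{\frac1\mu A[Z]}$ for all $\tau\in\mathbb C$ and all complex symmetric $A$. -/

import Mathlib

noncomputable section

namespace StarCP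

open CategoryTheory

/-! ### Complex projective space and the sheaves `O(k)[μ, μ⁻¹]]` -/

/-- Complex projective space `ℂPⁿ`, the space of lines in `ℂⁿ⁺¹`, with the quotient topology
of `ℂⁿ⁺¹ ∖ {0}`. -/
def CP (n : ℕ) : TopCat.{0} :=
  @TopCat.of (Projectivization ℂ (Fin (n + 1) → ℂ))
    (TopologicalSpace.coinduced
      (fun v : {v : Fin (n + 1) → ℂ // v ≠ 0} => Projectivization.mk ℂ v.1 v.2) inferInstance)

/-- The point `[z₀ : … : zₙ]` of `ℂPⁿ`. -/
def pt {n : ℕ} (z : Fin (n + 1) → ℂ) (hz : z ≠ 0) : CP n := Projectivization.mk ℂ z hz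

/-- The cone in `ℂⁿ⁺¹ ∖ {0}` over an open set of `ℂPⁿ`. -/
def cone {n : ℕ} (U : TopologicalSpace.Opens (CP n)) : Set (Fin (n + 1) → ℂ) :=
  {z | ∃ hz : z ≠ 0, pt z hz ∈ U}

theorem cone_mono {n : ℕ} {U V : TopologicalSpace.Opens (CP n)} (h : U ≤ V) :
    cone U ⊆ cone V := fun _ hz => ⟨hz.1, h hz.2⟩

theorem isOpen_cone {n : ℕ} (U : TopologicalSpace.Opens (CP n)) : IsOpen (cone U) := by
  have h1 : IsOpen ((fun v : {v : Fin (n + 1) → ℂ // v ≠ 0} => pt v.1 v.2) ⁻¹'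
      (U : Set (CP n))) := isOpen_coinduced.mp U.isOpen
  have h2 : cone U = Subtype.val '' ((fun v : {v : Fin (n + 1) → ℂ // v ≠ 0} => pt v.1 v.2) ⁻¹'
      (U : Set (CP n))) := by
    ext z
    constructor
    · rintro ⟨hz, h⟩
      exact ⟨⟨z, hz⟩, h, rfl⟩
    · rintro ⟨⟨w, hw⟩, h, rfl⟩
      exact ⟨hw, h⟩
  rw [h2]
  exact (isOpen_compl_singleton (x := (0 : Fin (n + 1) → ℂ))).isOpenMap_subtype_val _ h1

/-- Extension by zero of a function on the cone over `U`. It is only used near points of the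
(open) cone. -/
def ext0 {n : ℕ} {U : TopologicalSpace.Opens (CP n)} (f : cone U → ℂ) :
    (Fin (n + 1) → ℂ) → ℂ := Function.extend Subtype.val f 0

theorem ext0_apply {n : ℕ} {U : TopologicalSpace.Opens (CP n)} (f : cone U → ℂ) (z : cone U) :
    ext0 f z = f z := Subtype.val_injective.extend_apply f 0 z

/-- A family `(s m)` indexed by `m : ℤ` of functions on the cone over `U`, thought of as
`∑ₘ s m μᵐ`, is a section of `O(k)[μ, μ⁻¹]]` over `U` if every `s m` is a section of `O(k)`,
that is a holomorphic function which is homogeneous of degree `k`, and if locally on `U` only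
finitely many positive powers of `μ` occur. -/
structure IsSection {n : ℕ} (k : ℤ) (U : TopologicalSpace.Opens (CP n))
    (s : ℤ → cone U → ℂ) : Prop where
  holomorphic : ∀ (m : ℤ) (z : cone U), DifferentiableAt ℂ (ext0 (s m)) z
  homogeneous : ∀ (m : ℤ) (c : ℂ) (z w : cone U), c ≠ 0 → (w : Fin (n + 1) → ℂ) = c • z.1 →
    s m w = c ^ k * s m z
  bounded : ∀ x ∈ U, ∃ V : TopologicalSpace.Opens (CP n), x ∈ V ∧
    ∃ N : ℤ, ∀ m > N, ∀ z : cone U, z.1 ∈ cone V → s m z = 0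

theorem ext0_add {n : ℕ} {U : TopologicalSpace.Opens (CP n)} (f g : cone U → ℂ) :
    ext0 (f + g) = ext0 f + ext0 g := by
  funext z
  by_cases hz : z ∈ cone U
  · have h := fun f : cone U → ℂ => ext0_apply f ⟨z, hz⟩
    simp only at h
    simp [h]
  · have h : ∀ f : cone U → ℂ, ext0 f z = 0 := fun f =>
      Function.extend_apply' _ _ _ (by rintro ⟨w, rfl⟩; exact hz w.2)
    simp [h]

theorem ext0_neg {n : ℕ} {U : TopologicalSpace.Opens (CP n)} (f : cone U → ℂ) :
    ext0 (-f) = -ext0 f := by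
  funext z
  by_cases hz : z ∈ cone U
  · have h := fun f : cone U → ℂ => ext0_apply f ⟨z, hz⟩
    simp only at h
    simp [h]
  · have h : ∀ f : cone U → ℂ, ext0 f z = 0 := fun f =>
      Function.extend_apply' _ _ _ (by rintro ⟨w, rfl⟩; exact hz w.2)
    simp [h]

theorem ext0_zero {n : ℕ} {U : TopologicalSpace.Opens (CP n)} :
    ext0 (0 : cone U → ℂ) = 0 := by
  have h := ext0_add (0 : cone U → ℂ) 0
  simpa using h

/-- A function on `cone U` is holomorphic at `z` if it agrees near `z` with one that is. -/
theorem differentiableAt_ext0 {n : ℕ} {U : TopologicalSpace.Opens (CP n)} {f : cone U → ℂ}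
    {z : cone U} {F : (Fin (n + 1) → ℂ) → ℂ} (hF : DifferentiableAt ℂ F z)
    {W : Set (Fin (n + 1) → ℂ)} (hW : IsOpen W) (hz : z.1 ∈ W)
    (h : ∀ w : cone U, w.1 ∈ W → f w = F w) : DifferentiableAt ℂ (ext0 f) z := by
  refine hF.congr_of_eventuallyEq ?_
  filter_upwards [hW.mem_nhds hz, (isOpen_cone U).mem_nhds z.2] with w hw hw'
  rw [← h ⟨w, hw'⟩ hw]
  exact ext0_apply f ⟨w, hw'⟩

/-- The abelian group of sections of `O(k)[μ, μ⁻¹]]` over `U`. -/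
def sections (n : ℕ) (k : ℤ) (U : TopologicalSpace.Opens (CP n)) :
    AddSubgroup (ℤ → cone U → ℂ) where
  carrier := {s | IsSection k U s}
  zero_mem' :=
    { holomorphic := fun m z => by
        change DifferentiableAt ℂ (ext0 (0 : cone U → ℂ)) z
        rw [ext0_zero]
        exact differentiableAt_const (0 : ℂ)
      homogeneous := fun m c z w _ _ => by simp
      bounded := fun x hx => ⟨U, hx, 0, fun m _ z _ => rfl⟩ }
  add_mem' := fun {s t} hs ht =>
    { holomorphic := fun m z => by
        rw [Pi.add_apply, ext0_add]
        exact (hs.holomorphic m z).add (ht.holomorphic m z)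
      homogeneous := fun m c z w hc hw => by
        simp only [Pi.add_apply, hs.homogeneous m c z w hc hw, ht.homogeneous m c z w hc hw,
          mul_add]
      bounded := fun x hx => by
        obtain ⟨V, hV, N, hN⟩ := hs.bounded x hx
        obtain ⟨V', hV', N', hN'⟩ := ht.bounded x hx
        refine ⟨V ⊓ V', ⟨hV, hV'⟩, max N N', fun m hm z hz => ?_⟩
        simp only [Pi.add_apply]
        rw [hN m (lt_of_le_of_lt (le_max_left _ _) hm) z (cone_mono inf_le_left hz),
          hN' m (lt_of_le_of_lt (le_max_right _ _) hm) z (cone_mono inf_le_right hz), add_zero] }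
  neg_mem' := fun {s} hs =>
    { holomorphic := fun m z => by
        rw [Pi.neg_apply, ext0_neg]
        exact (hs.holomorphic m z).neg
      homogeneous := fun m c z w hc hw => by
        simp only [Pi.neg_apply, hs.homogeneous m c z w hc hw, mul_neg]
      bounded := fun x hx => by
        obtain ⟨V, hV, N, hN⟩ := hs.bounded x hx
        refine ⟨V, hV, N, fun m hm z hz => ?_⟩
        simp only [Pi.neg_apply, hN m hm z hz, neg_zero] }

/-- Restriction of sections. -/
def restrict (n : ℕ) (k : ℤ) {U V : TopologicalSpace.Opens (CP n)} (h : V ≤ U) :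
    sections n k U →+ sections n k V where
  toFun s := ⟨fun m z => s.1 m ⟨z.1, cone_mono h z.2⟩,
    { holomorphic := fun m z =>
        differentiableAt_ext0 (s.2.holomorphic m ⟨z.1, cone_mono h z.2⟩) (isOpen_cone U)
          (cone_mono h z.2) (fun w hw => (ext0_apply (s.1 m) ⟨w.1, hw⟩).symm)
      homogeneous := fun m c z w hc hw => s.2.homogeneous m c _ _ hc hw
      bounded := fun x hx => by
        obtain ⟨W, hW, N, hN⟩ := s.2.bounded x (h hx)
        exact ⟨W, hW, N, fun m hm z hz => hN m hm ⟨z.1, cone_mono h z.2⟩ hz⟩ }⟩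
  map_zero' := rfl
  map_add' _ _ := rfl

/-- The presheaf `O(k)[μ, μ⁻¹]]` on `ℂPⁿ`. -/
def presheafO (n : ℕ) (k : ℤ) : TopCat.Presheaf AddCommGrpCat.{0} (CP n) where
  obj U := AddCommGrpCat.of (sections n k U.unop)
  map i := AddCommGrpCat.ofHom (restrict n k (leOfHom i.unop))
  map_id _ := rfl
  map_comp _ _ := rfl

theorem isSheaf_presheafO (n : ℕ) (k : ℤ) : (presheafO n k).IsSheaf := by
  rw [TopCat.Presheaf.isSheaf_iff_isSheaf_comp (forget AddCommGrpCat.{0})]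
  apply TopCat.Presheaf.isSheaf_of_isSheafUniqueGluing_types
  intro ι U sf hsf
  change ∀ i, sections n k (U i) at sf
  have key : ∀ (i j : ι) (m : ℤ) (z : Fin (n + 1) → ℂ) (hi : z ∈ cone (U i))
      (hj : z ∈ cone (U j)), (sf i).1 m ⟨z, hi⟩ = (sf j).1 m ⟨z, hj⟩ := by
    intro i j m z hi hj
    have h := congrArg (fun t : sections n k (U i ⊓ U j) => t.1 m ⟨z, hi.1, hi.2, hj.2⟩)
      (hsf i j)
    exact h
  have hex : ∀ z : cone (iSup U), ∃ i, z.1 ∈ cone (U i) := by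
    rintro ⟨z, hz, hzU⟩
    obtain ⟨i, hi⟩ := TopologicalSpace.Opens.mem_iSup.mp hzU
    exact ⟨i, hz, hi⟩
  choose I hI using hex
  let s : ℤ → cone (iSup U) → ℂ := fun m z => (sf (I z)).1 m ⟨z.1, hI z⟩
  have hs : ∀ (m : ℤ) (z : cone (iSup U)) (i : ι) (hi : z.1 ∈ cone (U i)),
      s m z = (sf i).1 m ⟨z.1, hi⟩ := fun m z i hi => key _ _ m z.1 _ hi
  have hsec : IsSection k (iSup U) s :=
    { holomorphic := fun m z =>
        differentiableAt_ext0 ((sf (I z)).2.holomorphic m ⟨z.1, hI z⟩) (isOpen_cone (U (I z)))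
          (hI z) (fun w hw => by
            rw [hs m w _ hw]
            exact (ext0_apply ((sf (I z)).1 m) ⟨w.1, hw⟩).symm)
      homogeneous := fun m c z w hc hw => by
        have hw0 : w.1 ∈ cone (U (I z)) := by
          obtain ⟨hz, hzU⟩ := hI z
          refine ⟨w.2.1, ?_⟩
          have : pt w.1 w.2.1 = pt z.1 hz :=
            (Projectivization.mk_eq_mk_iff' ℂ _ _ _ _).mpr ⟨c, hw.symm⟩
          rw [this]
          exact hzU
        rw [hs m w _ hw0]
        exact (sf (I z)).2.homogeneous m c _ _ hc hw
      bounded := fun x hx => by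
        obtain ⟨i, hi⟩ := TopologicalSpace.Opens.mem_iSup.mp hx
        obtain ⟨V, hV, N, hN⟩ := (sf i).2.bounded x hi
        refine ⟨V ⊓ U i, ⟨hV, hi⟩, N, fun m hm z hz => ?_⟩
        rw [hs m z i (cone_mono inf_le_right hz)]
        exact hN m hm _ (cone_mono inf_le_left hz) }
  refine ⟨(⟨s, hsec⟩ : sections n k (iSup U)), ?_, ?_⟩
  · intro i
    apply Subtype.ext
    funext m z
    exact hs m ⟨z.1, cone_mono (le_iSup U i) z.2⟩ i z.2
  · intro t ht
    change sections n k (iSup U) at t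
    apply Subtype.ext
    funext m z
    have h := congrArg (fun r : sections n k (U (I z)) => r.1 m ⟨z.1, hI z⟩) (ht (I z))
    exact h

/-- The sheaf of abelian groups `O(k)[μ, μ⁻¹]]` on `ℂPⁿ`. -/
def sheafO (n : ℕ) (k : ℤ) : Sheaf (Opens.grothendieckTopology (CP n)) AddCommGrpCat.{0} :=
  ⟨presheafO n k, isSheaf_presheafO n k⟩

/-- The sheaf cohomology group `H⁰(ℂPⁿ, O(k)[μ, μ⁻¹]])`. -/
abbrev H0 (n : ℕ) (k : ℤ) : Type := Sheaf.H.{0} (sheafO n k) 0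

/-- The canonical isomorphism from the group of global sections to `H⁰`. -/
def ofGlobal {n : ℕ} {k : ℤ} : sections n k ⊤ ≃+ H0 n k :=
  (Sheaf.H.equiv₀ (sheafO n k)
    (T := (⊤ : TopologicalSpace.Opens (CP n))) Limits.isTerminalTop).symm

/-! ### Poisson structures in homogeneous coordinates and their star products -/

/-- The iterated partial derivative `∂_{α₁} ⋯ ∂_{αₖ} f`. -/
def iterPderiv {R : Type*} [CommRing R] {N k : ℕ} (α : Fin k → Fin N)
    (f : MvPolynomial (Fin N) R) : MvPolynomial (Fin N) R :=
  (List.ofFn α).foldr (fun i p => MvPolynomial.pderiv i p) f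

/-- The bidifferential expression
`Λ^{α₁β₁} ⋯ Λ^{αₖβₖ} (∂_{α₁} ⋯ ∂_{αₖ} f) (∂_{β₁} ⋯ ∂_{βₖ} g)`, summed over all indices. -/
def bidiff {R : Type*} [CommRing R] {N : ℕ} (Λ : Fin N → Fin N → MvPolynomial (Fin N) R) (k : ℕ)
    (f g : MvPolynomial (Fin N) R) : MvPolynomial (Fin N) R :=
  ∑ α : Fin k → Fin N, ∑ β : Fin k → Fin N,
    (∏ i, Λ (α i) (β i)) * iterPderiv α f * iterPderiv β g

/-- A holomorphic Poisson structure on `ℂPⁿ` in the homogeneous coordinates `z₀, …, zₙ`: the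
biderivation `{f, g} = Λ^{αβ} ∂_α f ∂_β g`, which preserves the degree of homogeneity (so the
`Λ^{αβ}` are quadratic forms), is skew-symmetric and satisfies the Jacobi identity. -/
structure Poisson (n : ℕ) where
  coeff : Fin (n + 1) → Fin (n + 1) → MvPolynomial (Fin (n + 1)) ℂ
  homogeneous : ∀ α β, (coeff α β).IsHomogeneous 2
  skew : ∀ α β, coeff β α = -coeff α β
  jacobi : ∀ f g h : MvPolynomial (Fin (n + 1)) ℂ,
    bidiff coeff 1 f (bidiff coeff 1 g h) + bidiff coeff 1 g (bidiff coeff 1 h f) +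
      bidiff coeff 1 h (bidiff coeff 1 f g) = 0

/-- The word `f (←∂_{α₁} Λ^{α₁β₁} ∂→_{β₁}) ⋯ (←∂_{αₖ} Λ^{αₖβₖ} ∂→_{βₖ})`, summed over all indices,
as a differential operator acting on whatever stands to its right. Every `∂→_β` differentiates
all that stands to its right; `←∂_α` differentiates all functions to its left, that is, it acts
on the operator `D` to its left by the commutator `⁅∂_α, D⁆`. -/
def arrowWord {N : ℕ} (Λ : Fin N → Fin N → MvPolynomial (Fin N) ℂ) (f : MvPolynomial (Fin N) ℂ) :
    ℕ → Module.End ℂ (MvPolynomial (Fin N) ℂ)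
  | 0 => LinearMap.mulLeft ℂ f
  | k + 1 => ∑ α : Fin N, ∑ β : Fin N,
      ⁅((MvPolynomial.pderiv α : Derivation ℂ _ _) : Module.End ℂ (MvPolynomial (Fin N) ℂ)),
        arrowWord Λ f k⁆ *
      LinearMap.mulLeft ℂ (Λ α β) *
      ((MvPolynomial.pderiv β : Derivation ℂ _ _) : Module.End ℂ (MvPolynomial (Fin N) ℂ))

/-- The condition
`(←∂_{α₁} Λ^{α₁β₁} ∂→_{β₁}) ⋯ (←∂_{αₖ} Λ^{αₖβₖ} ∂→_{βₖ})
  = ←∂_{α₁⋯αₖ} Λ^{α₁β₁} ⋯ Λ^{αₖβₖ} ∂→_{β₁⋯βₖ}` for all `k`. -/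
def Poisson.NormalOrdering {n : ℕ} (Λ : Poisson n) : Prop :=
  ∀ (k : ℕ) (f g : MvPolynomial (Fin (n + 1)) ℂ),
    arrowWord Λ.coeff f k g = bidiff Λ.coeff k f g

theorem bidiff_one {R : Type*} [CommRing R] {N : ℕ}
    (Λ : Fin N → Fin N → MvPolynomial (Fin N) R) (f g : MvPolynomial (Fin N) R) :
    bidiff Λ 1 f g =
      ∑ α, ∑ β, Λ α β * MvPolynomial.pderiv α f * MvPolynomial.pderiv β g := by
  unfold bidiff iterPderiv
  rw [← (Equiv.funUnique (Fin 1) (Fin N)).symm.sum_comp]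
  refine Finset.sum_congr rfl fun α _ => ?_
  rw [← (Equiv.funUnique (Fin 1) (Fin N)).symm.sum_comp]
  simp

/-- The rescaled Poisson structure `τ Λ`. -/
def Poisson.scale {n : ℕ} (τ : ℂ) (Λ : Poisson n) : Poisson n where
  coeff α β := MvPolynomial.C τ * Λ.coeff α β
  homogeneous α β := by
    simpa using (MvPolynomial.isHomogeneous_C _ τ).mul (Λ.homogeneous α β)
  skew α β := by rw [Λ.skew α β, mul_neg]
  jacobi f g h := by
    have h1 : ∀ f g, bidiff (fun α β => MvPolynomial.C τ * Λ.coeff α β) 1 f g =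
        MvPolynomial.C τ * bidiff Λ.coeff 1 f g := by
      intro f g
      simp only [bidiff_one, Finset.mul_sum, mul_assoc]
    have h2 : ∀ f g, bidiff Λ.coeff 1 f (MvPolynomial.C τ * g) =
        MvPolynomial.C τ * bidiff Λ.coeff 1 f g := by
      intro f g
      simp only [bidiff_one, Finset.mul_sum, MvPolynomial.pderiv_C_mul]
      refine Finset.sum_congr rfl fun α _ => Finset.sum_congr rfl fun β _ => ?_
      ring
    simp only [h1, h2]
    linear_combination MvPolynomial.C τ * MvPolynomial.C τ * Λ.jacobi f g h

open LaurentPolynomial in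
/-- The star product on `ℂ[Z][μ, μ⁻¹]`,
`f ⋆ g = ∑ₖ (1 / k!) (μ / 2)ᵏ Λ^{α₁β₁} ⋯ Λ^{αₖβₖ} (∂_{α₁} ⋯ ∂_{αₖ} f) (∂_{β₁} ⋯ ∂_{βₖ} g)`.
The variable `T` of `ℂ[T;T⁻¹]` is `μ`; the terms with `k` greater than the degree of `f`
vanish. -/
def star {n : ℕ} (Λ : Poisson n) (f g : MvPolynomial (Fin (n + 1)) ℂ[T;T⁻¹]) :
    MvPolynomial (Fin (n + 1)) ℂ[T;T⁻¹] :=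
  ∑ k ∈ Finset.range (f.totalDegree + 1),
    MvPolynomial.C (C ((k.factorial : ℂ)⁻¹ * (1 / 2) ^ k) * T (k : ℤ)) *
      bidiff (fun α β => MvPolynomial.map C (Λ.coeff α β)) k f g

theorem iterPderiv_isHomogeneous {R : Type*} [CommRing R] {N k d : ℕ} (α : Fin k → Fin N)
    {f : MvPolynomial (Fin N) R} (hf : f.IsHomogeneous d) :
    (iterPderiv α f).IsHomogeneous (d - k) ∧ (d < k → iterPderiv α f = 0) := by
  have h : ∀ l : List (Fin N),
      (l.foldr (fun i p => MvPolynomial.pderiv i p) f).IsHomogeneous (d - l.length) ∧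
      (d < l.length → l.foldr (fun i p => MvPolynomial.pderiv i p) f = 0) := by
    intro l
    induction l with
    | nil => simpa using hf
    | cons i l ih =>
      simp only [List.foldr_cons, List.length_cons]
      constructor
      · have := ih.1.pderiv (i := i)
        rwa [Nat.sub_sub] at this
      · intro hl
        rcases Nat.lt_or_ge d l.length with h1 | h1
        · rw [ih.2 h1, map_zero]
        · have h2 : d - l.length = 0 := by omega
          have h3 := ih.1
          rw [h2] at h3
          rw [MvPolynomial.totalDegree_eq_zero_iff_eq_C.mp
            (Nat.le_zero.mp h3.totalDegree_le), MvPolynomial.pderiv_C]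
  simpa [iterPderiv] using h (List.ofFn α)

theorem bidiff_isHomogeneous {R : Type*} [CommRing R] {N : ℕ}
    {Λ : Fin N → Fin N → MvPolynomial (Fin N) R} (hΛ : ∀ α β, (Λ α β).IsHomogeneous 2)
    (k : ℕ) {a b : ℕ} {f g : MvPolynomial (Fin N) R} (hf : f.IsHomogeneous a)
    (hg : g.IsHomogeneous b) : (bidiff Λ k f g).IsHomogeneous (a + b) := by
  refine MvPolynomial.IsHomogeneous.sum _ _ _ fun α _ =>
    MvPolynomial.IsHomogeneous.sum _ _ _ fun β _ => ?_
  obtain ⟨hf1, hf2⟩ := iterPderiv_isHomogeneous α hf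
  obtain ⟨hg1, hg2⟩ := iterPderiv_isHomogeneous β hg
  rcases Nat.lt_or_ge a k with h | ha
  · rw [hf2 h, mul_zero, zero_mul]
    exact MvPolynomial.isHomogeneous_zero _ _ _
  rcases Nat.lt_or_ge b k with h | hb
  · rw [hg2 h, mul_zero]
    exact MvPolynomial.isHomogeneous_zero _ _ _
  have h := ((MvPolynomial.IsHomogeneous.prod Finset.univ (fun i : Fin k => Λ (α i) (β i))
    (fun _ => 2) (fun i _ => hΛ _ _)).mul hf1).mul hg1
  convert! h using 1
  simp
  omega

open LaurentPolynomial in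
theorem star_isHomogeneous {n : ℕ} (Λ : Poisson n) {a b : ℕ}
    {f g : MvPolynomial (Fin (n + 1)) ℂ[T;T⁻¹]} (hf : f.IsHomogeneous a)
    (hg : g.IsHomogeneous b) : (star Λ f g).IsHomogeneous (a + b) := by
  refine MvPolynomial.IsHomogeneous.sum _ _ _ fun k _ => ?_
  have h := (MvPolynomial.isHomogeneous_C (Fin (n + 1))
    (C ((k.factorial : ℂ)⁻¹ * (1 / 2) ^ k) * T (k : ℤ) : ℂ[T;T⁻¹])).mul
    (bidiff_isHomogeneous (fun α β => (Λ.homogeneous α β).map C) k hf hg)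
  rwa [zero_add] at h

/-! ### Star exponentials and their classes in the sheaf cohomology -/

open LaurentPolynomial in
/-- Formal sums `∑_d F_d` of homogeneous polynomials `F_d` of degree `d` with coefficients in
`ℂ[μ, μ⁻¹]`. -/
abbrev FormalSum (n : ℕ) : Type :=
  (d : ℕ) → MvPolynomial.homogeneousSubmodule (Fin (n + 1)) ℂ[T;T⁻¹] d

/-- The star product of formal sums. -/
def starMul {n : ℕ} (Λ : Poisson n) (F G : FormalSum n) : FormalSum n := fun d =>
  ⟨∑ p ∈ Finset.HasAntidiagonal.antidiagonal d, star Λ (F p.1).1 (G p.2).1,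
    MvPolynomial.IsHomogeneous.sum _ _ _ fun p hp => by
      rw [← Finset.HasAntidiagonal.mem_antidiagonal.mp hp]
      exact star_isHomogeneous Λ (F p.1).2 (G p.2).2⟩

/-- The constant `1`, as a formal sum. -/
def oneSum (n : ℕ) : FormalSum n :=
  Pi.single 0 ⟨1, MvPolynomial.isHomogeneous_one _ _⟩

/-- The powers of `F` with respect to the star product. -/
def starPow {n : ℕ} (Λ : Poisson n) (F : FormalSum n) : ℕ → FormalSum n
  | 0 => oneSum n
  | m + 1 => starMul Λ F (starPow Λ F m)

open LaurentPolynomial in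
theorem isHomogeneous_C_mul_X_mul_X {n : ℕ} (a : ℂ[T;T⁻¹]) (i j : Fin (n + 1)) :
    (MvPolynomial.C a * (MvPolynomial.X i * MvPolynomial.X j) :
      MvPolynomial (Fin (n + 1)) ℂ[T;T⁻¹]).IsHomogeneous 2 := by
  have h := (MvPolynomial.isHomogeneous_C (Fin (n + 1)) a).mul
    ((MvPolynomial.isHomogeneous_X ℂ[T;T⁻¹] i).mul (MvPolynomial.isHomogeneous_X ℂ[T;T⁻¹] j))
  rwa [zero_add] at h

open LaurentPolynomial in
/-- `(1 / μ) A[Z]` for the quadratic form `A[Z] = ∑ A_{ij} z_i z_j`. -/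
def quadOverMu {n : ℕ} (A : Matrix (Fin (n + 1)) (Fin (n + 1)) ℂ) : FormalSum n :=
  Pi.single 2 ⟨∑ i, ∑ j, MvPolynomial.C (C (A i j) * T (-1)) *
      (MvPolynomial.X i * MvPolynomial.X j),
    MvPolynomial.IsHomogeneous.sum _ _ _ fun i _ =>
      MvPolynomial.IsHomogeneous.sum _ _ _ fun j _ => isHomogeneous_C_mul_X_mul_X _ i j⟩

open LaurentPolynomial in
/-- The star exponential `e_⋆^{A[Z]/μ} = ∑ₘ (1 / m!) (A[Z]/μ) ⋆ ⋯ ⋆ (A[Z]/μ)`. As the `m`-th star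
power of `A[Z]/μ` is homogeneous of degree `2m`, only terms with `m ≤ d` contribute in
degree `d`. -/
def starExp {n : ℕ} (Λ : Poisson n) (A : Matrix (Fin (n + 1)) (Fin (n + 1)) ℂ) : FormalSum n :=
  fun d => ∑ m ∈ Finset.range (d + 1),
    (C ((m.factorial : ℂ)⁻¹) : ℂ[T;T⁻¹]) • starPow Λ (quadOverMu A) m d

open LaurentPolynomial in
theorem coeff_eval_C {n : ℕ} (p : MvPolynomial (Fin (n + 1)) ℂ[T;T⁻¹]) (m : ℤ)
    (z : Fin (n + 1) → ℂ) : (MvPolynomial.eval (fun i => C (z i)) p).coeff m =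
      ∑ s ∈ p.support, (p.coeff s).coeff m * ∏ i, z i ^ s i := by
  rw [MvPolynomial.eval_eq']
  have h : ∀ s : Fin (n + 1) →₀ ℕ, (∏ i, (C (z i) : ℂ[T;T⁻¹]) ^ s i) = C (∏ i, z i ^ s i) := by
    intro s
    simp [map_prod, map_pow]
  simp only [h]
  rw [AddMonoidAlgebra.coeff_sum, Finsupp.finsetSum_apply]
  refine Finset.sum_congr rfl fun s _ => ?_
  rw [mul_comm, ← LaurentPolynomial.smul_eq_C_mul, mul_comm]
  simp

open LaurentPolynomial in
theorem isSection_eval {n d : ℕ} (p : MvPolynomial (Fin (n + 1)) ℂ[T;T⁻¹])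
    (hp : p.IsHomogeneous d) : IsSection (d : ℤ) ⊤
      (fun m (z : cone (⊤ : TopologicalSpace.Opens (CP n))) =>
        (MvPolynomial.eval (fun i => C (z.1 i)) p).coeff m) := by
  simp only [coeff_eval_C]
  refine ⟨fun m z => ?_, fun m c z w _ hw => ?_, fun x _ => ?_⟩
  · refine differentiableAt_ext0
      (F := fun z => ∑ s ∈ p.support, (p.coeff s).coeff m * ∏ i, z i ^ s i) ?_
      isOpen_univ (Set.mem_univ _) (fun w _ => rfl)
    fun_prop
  · rw [Finset.mul_sum]
    refine Finset.sum_congr rfl fun s hs => ?_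
    have hd : ∑ i, s i = d := by
      have := hp (MvPolynomial.mem_support_iff.mp hs)
      rwa [← Finsupp.degree_eq_sum, Finsupp.degree_eq_weight_one]
    simp only [hw, Pi.smul_apply, smul_eq_mul, mul_pow, Finset.prod_mul_distrib,
      Finset.prod_pow_eq_pow_sum, hd, zpow_natCast]
    ring
  · have h : ∃ N : ℤ, ∀ m > N, ∀ s ∈ p.support, (p.coeff s).coeff m = 0 := by
      obtain ⟨N, hN⟩ := (p.support.biUnion fun s => (p.coeff s).coeff.support).bddAbove
      refine ⟨N, fun m hm s hs => ?_⟩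
      by_contra h0
      exact absurd (hN (Finset.mem_biUnion.mpr ⟨s, hs, Finsupp.mem_support_iff.mpr h0⟩))
        (not_le.mpr hm)
    obtain ⟨N, hN⟩ := h
    refine ⟨⊤, trivial, N, fun m hm z _ => Finset.sum_eq_zero fun s hs => ?_⟩
    rw [hN m hm s hs, zero_mul]

open LaurentPolynomial in
/-- A homogeneous polynomial `p = ∑ₘ pₘ(Z) μᵐ` of degree `d` as a global section of
`O(d)[μ, μ⁻¹]]`. -/
def toSection {n d : ℕ} (p : MvPolynomial.homogeneousSubmodule (Fin (n + 1)) ℂ[T;T⁻¹] d) :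
    sections n d ⊤ :=
  ⟨fun m z => (MvPolynomial.eval (fun i => C (z.1 i)) p.1).coeff m, isSection_eval p.1 p.2⟩

/-- The class of a formal sum in `∏_d H⁰(ℂPⁿ, O(d)[μ, μ⁻¹]])`, the space of formal sums
of elements of the groups `H⁰(ℂPⁿ, O(d)[μ, μ⁻¹]])`. -/
def cohomologyClass {n : ℕ} (F : FormalSum n) : (d : ℕ) → H0 n d :=
  fun d => ofGlobal (toSection (F d))

end StarCP

end

noncomputable section

namespace StarCP

open MvPolynomial

/-! ### Bidifferential expressions of low order -/

section Bidiff

variable {R : Type*} [CommRing R] {N : ℕ}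

/-! Classes: $H^0$ is the group of global sections, and a polynomial is determined by its values, so
everything reduces to formal sums (`cohomologyClass_injective`).

Detection: pick $i,j$ with $\Lambda^{ij}\ne 0$ and look at degree 4, where the relevant elements are
explicit combinations of $q\star_\tau q'$ for quadratic $q,q'$ (`starMul_starExp_degree_four`,
`starExp_degree_four`). For diagonal forms divided by $\mu$ this product is $qq'$, plus $\mu^{-1}$
times a term linear in $\tau$, plus a $\mu$-free term quadratic in $\tau$ (`star_diagonal`). With
$A=z_i^2$, $B=z_j^2$ the $\mu^{-1}$ term is a multiple of $\tau\Lambda^{ij}z_iz_j$ and recovers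
$\tau$. With $A=z_i^2+z_j^2$ alone, the $\mu^0$ term is a multiple of $\tau^2(\Lambda^{ij})^2$ and
recovers $\tau^2$.

Sign: write $X_a=\Lambda^{ab}\partial_b$. Normal ordering for $k=2$ together with Jacobi forces
$X_a\Lambda^{bc}=0$ (`Poisson.NormalOrdering.coordInvariant`), so the $X_a$ commute. For quadratic
$q$, left star multiplication is $q+\tfrac{\mu\tau}{2}D_1+\tfrac{\mu^2\tau^2}{8}D_2$ with
$D_1=\{q,\cdot\}$, and $D_1$ commutes with $D_2$ (`CoordInvariant.bidiff_one_bidiff_two`). Since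
$D_1q=0$, induction shows that $D_1$ kills every star power of $q$, so only $\tau^2$ enters
(`starPow_scale_neg`). -/

theorem bidiff_zero_order (L : Fin N → Fin N → MvPolynomial (Fin N) R)
    (f g : MvPolynomial (Fin N) R) : bidiff L 0 f g = f * g := by
  simp [bidiff, iterPderiv]

theorem bidiff_two (L : Fin N → Fin N → MvPolynomial (Fin N) R)
    (f g : MvPolynomial (Fin N) R) :
    bidiff L 2 f g = ∑ a, ∑ b, ∑ c, ∑ d,
      L a c * L b d * pderiv a (pderiv b f) * pderiv c (pderiv d g) := by
  unfold bidiff iterPderiv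
  rw [← (finTwoArrowEquiv (Fin N)).symm.sum_comp, Fintype.sum_prod_type]
  refine Finset.sum_congr rfl fun a _ => Finset.sum_congr rfl fun b _ => ?_
  rw [← (finTwoArrowEquiv (Fin N)).symm.sum_comp, Fintype.sum_prod_type]
  refine Finset.sum_congr rfl fun c _ => Finset.sum_congr rfl fun d _ => ?_
  simp [Fin.prod_univ_two, List.ofFn_succ]

theorem bidiff_C_mul (L : Fin N → Fin N → MvPolynomial (Fin N) R) (t : R) (k : ℕ)
    (f g : MvPolynomial (Fin N) R) :
    bidiff (fun a b => C t * L a b) k f g = C (t ^ k) * bidiff L k f g := by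
  simp only [bidiff, Finset.mul_sum, Finset.prod_mul_distrib, Finset.prod_const,
    Finset.card_univ, Fintype.card_fin, map_pow, mul_assoc]

/-- The Hamiltonian vector field `L^{aβ} ∂_β` of the coordinate `z_a`. -/
def coordField (L : Fin N → Fin N → MvPolynomial (Fin N) R) (a : Fin N) :
    Derivation R (MvPolynomial (Fin N) R) (MvPolynomial (Fin N) R) :=
  ∑ b, L a b • pderiv b

theorem coordField_apply (L : Fin N → Fin N → MvPolynomial (Fin N) R) (a : Fin N)
    (u : MvPolynomial (Fin N) R) : coordField L a u = ∑ b, L a b * pderiv b u := by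
  have h : ∀ s : Finset (Fin N), (∑ b ∈ s, L a b • pderiv b :
      Derivation R (MvPolynomial (Fin N) R) (MvPolynomial (Fin N) R)) u =
      ∑ b ∈ s, L a b * pderiv b u := by
    intro s
    induction s using Finset.cons_induction with
    | empty => simp
    | cons i s hi ih =>
      rw [Finset.sum_cons, Finset.sum_cons, Derivation.add_apply, ih, Derivation.smul_apply,
        smul_eq_mul]
  exact h Finset.univ

@[simp]
theorem coordField_C (L : Fin N → Fin N → MvPolynomial (Fin N) R) (a : Fin N) (r : R) :
    coordField L a (C r) = 0 := by
  simp

/-- The structure functions are constant along the Hamiltonian vector fields of the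
coordinates. -/
def CoordInvariant (L : Fin N → Fin N → MvPolynomial (Fin N) R) : Prop :=
  ∀ a b c, coordField L a (L b c) = 0

theorem bidiff_one_eq (L : Fin N → Fin N → MvPolynomial (Fin N) R)
    (f g : MvPolynomial (Fin N) R) :
    bidiff L 1 f g = ∑ a, pderiv a f * coordField L a g := by
  rw [bidiff_one]
  refine Finset.sum_congr rfl fun a _ => ?_
  rw [coordField_apply, Finset.mul_sum]
  refine Finset.sum_congr rfl fun b _ => ?_
  ring

variable {L : Fin N → Fin N → MvPolynomial (Fin N) R}

/-- Invariance removes the term in which the outer field differentiates the coefficients of the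
inner one, so the composite is purely of second order. Its coefficients then show that the fields
commute. -/
theorem CoordInvariant.coordField_coordField (hL : CoordInvariant L) (a b : Fin N)
    (u : MvPolynomial (Fin N) R) :
    coordField L a (coordField L b u) =
      ∑ c, ∑ d, L a c * L b d * pderiv c (pderiv d u) := by
  rw [coordField_apply L b, map_sum, Finset.sum_comm]
  refine Finset.sum_congr rfl fun d _ => ?_
  rw [Derivation.leibniz, hL a b d, smul_zero, add_zero, coordField_apply, smul_eq_mul,
    Finset.mul_sum]
  refine Finset.sum_congr rfl fun c _ => ?_
  ring

theorem pderiv_comm_apply (a b : Fin N) (u : MvPolynomial (Fin N) R) :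
    pderiv a (pderiv b u) = pderiv b (pderiv a u) := by
  have h : ⁅(pderiv a : Derivation R (MvPolynomial (Fin N) R) (MvPolynomial (Fin N) R)),
      (pderiv b : Derivation R (MvPolynomial (Fin N) R) (MvPolynomial (Fin N) R))⁆ = 0 := by
    apply MvPolynomial.derivation_ext
    intro i
    rw [Derivation.commutator_apply]
    simp [pderiv_X, Pi.single_apply, apply_ite]
  have h2 := congrArg (fun D => D u) h
  simpa [Derivation.commutator_apply, sub_eq_zero] using h2

theorem CoordInvariant.comm (hL : CoordInvariant L) (a b : Fin N)
    (u : MvPolynomial (Fin N) R) :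
    coordField L a (coordField L b u) = coordField L b (coordField L a u) := by
  rw [hL.coordField_coordField, hL.coordField_coordField, Finset.sum_comm]
  refine Finset.sum_congr rfl fun c _ => Finset.sum_congr rfl fun d _ => ?_
  rw [pderiv_comm_apply c d]
  ring

/-- For quadratic `q` the Hessian is constant, and the second order part becomes a
constant-coefficient quadratic expression in commuting vector fields. -/
theorem CoordInvariant.bidiff_two (hL : CoordInvariant L) {q : MvPolynomial (Fin N) R}
    {G : Fin N → Fin N → R} (hG : ∀ a b, pderiv a (pderiv b q) = C (G a b))
    (u : MvPolynomial (Fin N) R) :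
    bidiff L 2 q u = ∑ a, ∑ b, C (G a b) * coordField L a (coordField L b u) := by
  rw [StarCP.bidiff_two]
  refine Finset.sum_congr rfl fun a _ => Finset.sum_congr rfl fun b _ => ?_
  rw [hL.coordField_coordField, Finset.mul_sum]
  refine Finset.sum_congr rfl fun c _ => ?_
  rw [Finset.mul_sum]
  refine Finset.sum_congr rfl fun d _ => ?_
  rw [hG]
  ring

theorem bidiff_one_mul (f g u : MvPolynomial (Fin N) R) :
    bidiff L 1 f (g * u) = bidiff L 1 f g * u + g * bidiff L 1 f u := by
  simp only [bidiff_one_eq, Derivation.leibniz, smul_eq_mul, Finset.sum_mul, Finset.mul_sum,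
    ← Finset.sum_add_distrib]
  refine Finset.sum_congr rfl fun a _ => ?_
  ring

variable [IsDomain R] [CharZero R]

theorem bidiff_one_self (hs : ∀ a b, L b a = -L a b) (q : MvPolynomial (Fin N) R) :
    bidiff L 1 q q = 0 := by
  have h : bidiff L 1 q q = -bidiff L 1 q q := by
    conv_lhs => rw [bidiff_one, Finset.sum_comm]
    rw [bidiff_one]
    simp only [← Finset.sum_neg_distrib]
    refine Finset.sum_congr rfl fun a _ => Finset.sum_congr rfl fun b _ => ?_
    rw [hs a b]
    ring
  exact CharZero.eq_neg_self_iff.mp h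

/-- For quadratic `q`, the first and second order parts of the star product with `q`
commute. -/
theorem CoordInvariant.bidiff_one_bidiff_two (hL : CoordInvariant L)
    (hs : ∀ a b, L b a = -L a b) {q : MvPolynomial (Fin N) R}
    {G : Fin N → Fin N → R} (hG : ∀ a b, pderiv a (pderiv b q) = C (G a b))
    (u : MvPolynomial (Fin N) R) :
    bidiff L 1 q (bidiff L 2 q u) = bidiff L 2 q (bidiff L 1 q u) := by
  set X := coordField L with hX
  have hGs : ∀ a b, G a b = G b a := fun a b =>
    C_injective (Fin N) R (by rw [← hG, ← hG, pderiv_comm_apply])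
  -- These are the coefficients of the commutator of `X c` with `bidiff L 1 q` (see `hXD`). Being
  -- constant combinations of the `L c d`, they are killed by every `X b`.
  let E : Fin N → Fin N → MvPolynomial (Fin N) R := fun c a => X c (pderiv a q)
  have hE : ∀ c a, E c a = ∑ d, L c d * C (G d a) := fun c a => by
    simp only [E, hX, coordField_apply, hG]
  have hXE : ∀ b c a, X b (E c a) = 0 := fun b c a => by
    rw [hE, map_sum]
    refine Finset.sum_eq_zero fun d _ => ?_
    rw [Derivation.leibniz, hX, hL, coordField_C, smul_zero, smul_zero, add_zero]
  have hXD : ∀ c v, X c (bidiff L 1 q v) = bidiff L 1 q (X c v) + ∑ a, E c a * X a v := by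
    intro c v
    rw [bidiff_one_eq, bidiff_one_eq, map_sum, ← Finset.sum_add_distrib]
    refine Finset.sum_congr rfl fun a _ => ?_
    rw [Derivation.leibniz, smul_eq_mul, smul_eq_mul, hX, hL.comm c a]
    ring
  have hD : ∀ (s : Finset (Fin N)) (w : Fin N → MvPolynomial (Fin N) R),
      bidiff L 1 q (∑ i ∈ s, w i) = ∑ i ∈ s, bidiff L 1 q (w i) := by
    intro s w
    simp only [bidiff_one_eq, map_sum, Finset.mul_sum]
    exact Finset.sum_comm
  have hDC : ∀ r v, bidiff L 1 q (C r * v) = C r * bidiff L 1 q v := by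
    intro r v
    rw [bidiff_one_mul, bidiff_one_eq]
    simp
  have hXX : ∀ b c, X b (X c (bidiff L 1 q u)) = bidiff L 1 q (X b (X c u)) +
      (∑ a, E b a * X a (X c u) + ∑ a, E c a * X a (X b u)) := by
    intro b c
    rw [hXD, map_add, hXD, map_sum, add_assoc]
    congr 2
    refine Finset.sum_congr rfl fun a _ => ?_
    rw [Derivation.leibniz, hXE, smul_zero, add_zero, smul_eq_mul, hX, hL.comm b a]
  -- After expanding `E`, the factor `L b d` is antisymmetric in `b, d`, while the remaining sum
  -- over `a, c` is symmetric in them because the fields commute. The whole sum equals its own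
  -- negative.
  have hzero : ∑ b, ∑ c, C (G b c) * ∑ a, E b a * X a (X c u) = 0 := by
    have h1 : ∑ b, ∑ c, C (G b c) * ∑ a, E b a * X a (X c u) =
        ∑ b, ∑ d, L b d * ∑ c, ∑ a, C (G b c) * C (G d a) * X a (X c u) := by
      refine Finset.sum_congr rfl fun b _ => ?_
      simp only [hE, Finset.sum_mul, Finset.mul_sum]
      rw [Finset.sum_congr rfl fun c _ => Finset.sum_comm, Finset.sum_comm]
      refine Finset.sum_congr rfl fun d _ => Finset.sum_congr rfl fun c _ =>
        Finset.sum_congr rfl fun a _ => ?_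
      ring
    rw [h1]
    refine CharZero.eq_neg_self_iff.mp ?_
    conv_lhs => rw [Finset.sum_comm]
    simp only [← Finset.sum_neg_distrib]
    refine Finset.sum_congr rfl fun b _ => Finset.sum_congr rfl fun d _ => ?_
    rw [hs b d, neg_mul, Finset.sum_comm]
    congr 2
    refine Finset.sum_congr rfl fun a _ => Finset.sum_congr rfl fun c _ => ?_
    rw [hX, hL.comm]
    ring
  have hzero' : ∑ b, ∑ c, C (G b c) * ∑ a, E c a * X a (X b u) = 0 := by
    rw [Finset.sum_comm, ← hzero]
    refine Finset.sum_congr rfl fun b _ => Finset.sum_congr rfl fun c _ => ?_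
    rw [hGs]
  rw [hL.bidiff_two hG, hL.bidiff_two hG]
  simp only [← hX, hXX, mul_add, Finset.sum_add_distrib]
  rw [hzero, hzero', add_zero, add_zero, hD]
  refine Finset.sum_congr rfl fun b _ => ?_
  rw [hD]
  exact Finset.sum_congr rfl fun c _ => hDC _ _

end Bidiff

/-! ### Normal ordering forces the structure functions to be Casimir functions -/

theorem coordField_map {R S : Type*} [CommRing R] [CommRing S] {N : ℕ} (φ : R →+* S)
    (L : Fin N → Fin N → MvPolynomial (Fin N) R) (a : Fin N) (u : MvPolynomial (Fin N) R) :
    coordField (fun a b => map φ (L a b)) a (map φ u) = map φ (coordField L a u) := by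
  simp [coordField_apply, pderiv_map]

theorem Poisson.coordField_skew {n : ℕ} (Λ : Poisson n) (a b c : Fin (n + 1)) :
    coordField Λ.coeff a (Λ.coeff c b) = -coordField Λ.coeff a (Λ.coeff b c) := by
  rw [Λ.skew b c, map_neg]

theorem Poisson.coordField_jacobi {n : ℕ} (Λ : Poisson n) (a b c : Fin (n + 1)) :
    coordField Λ.coeff a (Λ.coeff b c) + coordField Λ.coeff b (Λ.coeff c a) +
      coordField Λ.coeff c (Λ.coeff a b) = 0 := by
  have h1 : ∀ a u, bidiff Λ.coeff 1 (X a) u = coordField Λ.coeff a u := by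
    intro a u
    simp [bidiff_one_eq, pderiv_X, Pi.single_apply]
  have h2 : ∀ a b, coordField Λ.coeff a (X b) = Λ.coeff a b := by
    intro a b
    simp [coordField_apply, pderiv_X, Pi.single_apply]
  simpa only [h1, h2] using Λ.jacobi (X a) (X b) (X c)

/-- This is normal ordering for `k = 2` tested on a coordinate function: the ordered side vanishes
because second derivatives of a coordinate do. -/
theorem Poisson.NormalOrdering.sum_pderiv_eq_zero {n : ℕ} {Λ : Poisson n}
    (hΛ : Λ.NormalOrdering) (f : MvPolynomial (Fin (n + 1)) ℂ) (c : Fin (n + 1)) :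
    ∑ d, ∑ a, ∑ b, pderiv d (pderiv a f * Λ.coeff a b) * pderiv b (Λ.coeff d c) = 0 := by
  have h := hΛ 2 f (X c)
  have h0 : bidiff Λ.coeff 2 f (X c) = 0 := by
    rw [bidiff_two]
    refine Finset.sum_eq_zero fun a _ => Finset.sum_eq_zero fun b _ =>
      Finset.sum_eq_zero fun e _ => Finset.sum_eq_zero fun d _ => ?_
    simp [pderiv_X, Pi.single_apply, apply_ite]
  have h1 : ∀ u, arrowWord Λ.coeff f 1 u =
      ∑ a, ∑ b, pderiv a f * Λ.coeff a b * pderiv b u := by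
    intro u
    rw [hΛ, bidiff_one]
    refine Finset.sum_congr rfl fun a _ => Finset.sum_congr rfl fun b _ => ?_
    ring
  rw [h0] at h
  rw [← h]
  change _ = (∑ d, ∑ e,
      ⁅((pderiv d : Derivation ℂ _ _) : Module.End ℂ (MvPolynomial (Fin (n + 1)) ℂ)),
        arrowWord Λ.coeff f 1⁆ * LinearMap.mulLeft ℂ (Λ.coeff d e) *
      ((pderiv e : Derivation ℂ _ _) : Module.End ℂ (MvPolynomial (Fin (n + 1)) ℂ))) (X c)
  simp only [LinearMap.sum_apply, Module.End.mul_apply, Derivation.coeFn_coe, pderiv_X,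
    LinearMap.mulLeft_apply]
  refine Finset.sum_congr rfl fun d _ => ?_
  refine Eq.trans ?_ (Finset.sum_eq_single c ?_ ?_).symm
  -- In the commutator the second derivatives of `Λ.coeff d c` cancel, leaving only the derivative
  -- of the coefficient `pderiv a f * Λ.coeff a b`.
  · rw [Pi.single_eq_same, mul_one, Ring.lie_def, LinearMap.sub_apply, Module.End.mul_apply,
      Module.End.mul_apply, h1, h1, Derivation.coeFn_coe]
    simp only [map_sum, ← Finset.sum_sub_distrib]
    refine Finset.sum_congr rfl fun a _ => Finset.sum_congr rfl fun b _ => ?_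
    rw [Derivation.leibniz _ (pderiv a f * Λ.coeff a b), pderiv_comm_apply d b, smul_eq_mul,
      smul_eq_mul]
    ring
  · intro e _ he
    rw [Pi.single_eq_of_ne' he, mul_zero, map_zero]
  · simp

theorem sum_pderiv_X_mul {R : Type*} [CommRing R] {N : ℕ}
    (L : Fin N → Fin N → MvPolynomial (Fin N) R) (K : Fin N → MvPolynomial (Fin N) R)
    (w : MvPolynomial (Fin N) R) (a d : Fin N) :
    ∑ e, ∑ g, pderiv d (pderiv e (X a) * w * L e g) * K g =
      ∑ g, pderiv d (w * L a g) * K g := by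
  rw [Finset.sum_eq_single a]
  · simp
  · intro e _ he
    refine Finset.sum_eq_zero fun g _ => ?_
    rw [pderiv_X_of_ne he.symm, zero_mul, zero_mul, map_zero, zero_mul]
  · simp

/-- The product rule for `X a * X b` separates multiples of the expressions already known to vanish
from linear `f`; the Kronecker terms, where `pderiv d` hits a coordinate, carry the new information.
-/
theorem sum_pderiv_X_mul_X {R : Type*} [CommRing R] {N : ℕ}
    (L : Fin N → Fin N → MvPolynomial (Fin N) R) (a b c d : Fin N) :
    ∑ e, ∑ g, pderiv d (pderiv e (X a * X b) * L e g) * pderiv g (L d c) =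
      X a * ∑ g, pderiv d (L b g) * pderiv g (L d c) +
        X b * ∑ g, pderiv d (L a g) * pderiv g (L d c) +
        ((if d = a then coordField L b (L d c) else 0) +
          (if d = b then coordField L a (L d c) else 0)) := by
  have e1 := sum_pderiv_X_mul L (fun g => pderiv g (L d c)) (X b) a d
  have e2 := sum_pderiv_X_mul L (fun g => pderiv g (L d c)) (X a) b d
  have e3 : ∀ (i j : Fin N), ∑ g, pderiv d (X i * L j g) *
      pderiv g (L d c) = X i * ∑ g, pderiv d (L j g) * pderiv g (L d c) +
      if d = i then coordField L j (L d c) else 0 := by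
    intro i j
    rw [coordField_apply, Finset.mul_sum]
    split_ifs with hd
    · subst hd
      rw [← Finset.sum_add_distrib]
      refine Finset.sum_congr rfl fun g _ => ?_
      rw [Derivation.leibniz, pderiv_X_self, smul_eq_mul, smul_eq_mul]
      ring
    · rw [add_zero]
      refine Finset.sum_congr rfl fun g _ => ?_
      rw [Derivation.leibniz, pderiv_X_of_ne (Ne.symm hd), smul_zero, add_zero, smul_eq_mul]
      ring
  have e4 : ∀ e g, pderiv d (pderiv e (X a * X b) * L e g) *
      pderiv g (L d c) =
      pderiv d (pderiv e (X a) * X b * L e g) * pderiv g (L d c) +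
      pderiv d (pderiv e (X b) * X a * L e g) * pderiv g (L d c) := by
    intro e g
    rw [← add_mul, ← map_add, ← add_mul, Derivation.leibniz _ (X a) (X b), smul_eq_mul, smul_eq_mul]
    congr 3
    ring
  simp only [e4, Finset.sum_add_distrib, e1, e2, e3]
  ring

/-- Testing on `X a` and then on `X a * X b` shows that $X_a\Lambda^{bc}$ is antisymmetric in $a,b$.
It is antisymmetric in $b,c$ as well, hence totally antisymmetric, so the three terms of the cyclic
Jacobi sum are equal. -/
theorem Poisson.NormalOrdering.coordInvariant {n : ℕ} {Λ : Poisson n}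
    (hΛ : Λ.NormalOrdering) : CoordInvariant Λ.coeff := by
  have h1 : ∀ a c, ∑ d, ∑ b, pderiv d (Λ.coeff a b) * pderiv b (Λ.coeff d c) = 0 := by
    intro a c
    have h := hΛ.sum_pderiv_eq_zero (X a) c
    rw [← h]
    refine Finset.sum_congr rfl fun d _ => ?_
    have h3 := sum_pderiv_X_mul Λ.coeff (fun g => pderiv g (Λ.coeff d c)) 1 a d
    simp only [mul_one, one_mul] at h3
    exact h3.symm
  have h2 : ∀ a b c, coordField Λ.coeff a (Λ.coeff b c) +
      coordField Λ.coeff b (Λ.coeff a c) = 0 := by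
    intro a b c
    have h := hΛ.sum_pderiv_eq_zero (X a * X b) c
    simp only [sum_pderiv_X_mul_X, Finset.sum_add_distrib, ← Finset.mul_sum, h1, mul_zero, zero_add,
      Finset.sum_ite_eq', Finset.mem_univ, if_true] at h
    exact (add_comm _ _).trans h
  intro a b c
  have e1 := Λ.coordField_jacobi a b c
  have e2 := h2 a b c
  have e3 := h2 a c b
  have e4 := Λ.coordField_skew a b c
  have e5 := Λ.coordField_skew b a c
  have e6 := Λ.coordField_skew c a b
  have h3 : 3 * coordField Λ.coeff a (Λ.coeff b c) = 0 := by
    linear_combination e1 + e2 - e5 - e3 + e4 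
  exact (mul_eq_zero.mp h3).resolve_left (by norm_num)

/-! ### A formal sum is determined by its cohomology class -/

section Injectivity

open LaurentPolynomial

theorem laurentC_injective : Function.Injective (C : ℂ → ℂ[T;T⁻¹]) := fun a b h => by
  simpa using congrArg (fun p : ℂ[T;T⁻¹] => p.coeff 0) h

instance charZero_laurent : CharZero ℂ[T;T⁻¹] :=
  charZero_of_injective_ringHom (f := (C : ℂ →+* ℂ[T;T⁻¹])) laurentC_injective

/-- A polynomial over the domain $\mathbb C[\mu,\mu^{-1}]$ is determined by its values on a product
of infinite sets; nonzero complex constants suffice. -/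
theorem toSection_injective {n d : ℕ} :
    Function.Injective (toSection (n := n) (d := d)) := by
  intro p q h
  apply Subtype.ext
  refine MvPolynomial.funext_set (fun _ => (C : ℂ → ℂ[T;T⁻¹]) '' {0}ᶜ) (fun _ => ?_) fun x hx => ?_
  · exact (Set.finite_singleton (0 : ℂ)).infinite_compl.image laurentC_injective.injOn
  · choose z hz hzx using fun i => hx i (Set.mem_univ i)
    -- Excluding zero from each coordinate keeps the evaluation points inside the cone, where
    -- sections are defined.
    have hz0 : z ≠ 0 := fun h0 => hz 0 (congrFun h0 0)
    obtain rfl : (fun i => LaurentPolynomial.C (z i)) = x := funext hzx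
    apply LaurentPolynomial.ext
    intro m
    exact congrFun (congrFun (congrArg Subtype.val h) m) ⟨z, hz0, trivial⟩

theorem cohomologyClass_injective {n : ℕ} :
    Function.Injective (cohomologyClass (n := n)) := by
  intro F G h
  funext d
  exact toSection_injective (ofGlobal.injective (congrFun h d))

end Injectivity

/-! ### The star product with a quadratic form -/

section Star

open LaurentPolynomial (T)

variable {n : ℕ}

local notation "R" => LaurentPolynomial ℂ

local notation "P" => MvPolynomial (Fin (n + 1)) (LaurentPolynomial ℂ)

/-- The structure functions of `Λ`, with coefficients in `ℂ[μ, μ⁻¹]`. -/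
def Poisson.lift (Λ : Poisson n) (a b : Fin (n + 1)) : P :=
  map LaurentPolynomial.C (Λ.coeff a b)

theorem Poisson.lift_skew (Λ : Poisson n) (a b : Fin (n + 1)) : Λ.lift b a = -Λ.lift a b := by
  simp only [Poisson.lift, Λ.skew a b, map_neg]

theorem Poisson.NormalOrdering.lift_coordInvariant {Λ : Poisson n} (hΛ : Λ.NormalOrdering) :
    CoordInvariant Λ.lift := fun a b c => by
  have h := coordField_map (LaurentPolynomial.C : ℂ →+* R) Λ.coeff a (Λ.coeff b c)
  rwa [hΛ.coordInvariant, map_zero] at h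

theorem iterPderiv_zero {S : Type*} [CommRing S] {N k : ℕ} (α : Fin k → Fin N) :
    iterPderiv α (0 : MvPolynomial (Fin N) S) = 0 := by
  unfold iterPderiv
  induction List.ofFn α with
  | nil => rfl
  | cons i l ih => rw [List.foldr_cons, ih, map_zero]

theorem bidiff_zero_left {S : Type*} [CommRing S] {N : ℕ}
    (L : Fin N → Fin N → MvPolynomial (Fin N) S) (k : ℕ) (g : MvPolynomial (Fin N) S) :
    bidiff L k 0 g = 0 := by
  simp [bidiff, iterPderiv_zero]

theorem bidiff_zero_right {S : Type*} [CommRing S] {N : ℕ}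
    (L : Fin N → Fin N → MvPolynomial (Fin N) S) (k : ℕ) (f : MvPolynomial (Fin N) S) :
    bidiff L k f 0 = 0 := by
  simp [bidiff, iterPderiv_zero]

theorem star_zero_left (Λ : Poisson n) (g : P) : star Λ 0 g = 0 := by
  simp [star, bidiff_zero_left]

theorem star_zero_right (Λ : Poisson n) (f : P) : star Λ f 0 = 0 := by
  simp [star, bidiff_zero_right]

theorem star_one_left (Λ : Poisson n) (g : P) : star Λ 1 g = g := by
  simp [star, bidiff_zero_order]

theorem star_scale (Λ : Poisson n) (τ : ℂ) {a : ℕ} {f : P} (hf : f.IsHomogeneous a) (g : P) :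
    star (Λ.scale τ) f g = ∑ k ∈ Finset.range (a + 1),
      C (LaurentPolynomial.C ((k.factorial : ℂ)⁻¹ * (1 / 2) ^ k * τ ^ k) * T (k : ℤ)) *
        bidiff Λ.lift k f g := by
  -- The cutoff in `star` is `totalDegree`, which equals `a` only for nonzero `f`.
  rcases eq_or_ne f 0 with rfl | h0
  · simp [star_zero_left, bidiff_zero_left]
  · unfold star
    rw [hf.totalDegree h0]
    refine Finset.sum_congr rfl fun k _ => ?_
    have h : (fun α β => map LaurentPolynomial.C ((Λ.scale τ).coeff α β)) =
        fun α β => C (LaurentPolynomial.C τ) * Λ.lift α β := by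
      funext α β
      simp [Poisson.scale, Poisson.lift]
    rw [h, bidiff_C_mul]
    simp only [map_mul, map_pow]
    ring

/-- The quadratic polynomial `A[Z] / μ`. -/
def quadPoly (A : Matrix (Fin (n + 1)) (Fin (n + 1)) ℂ) : P := (quadOverMu A 2).1

theorem quadPoly_eq (A : Matrix (Fin (n + 1)) (Fin (n + 1)) ℂ) :
    quadPoly A = ∑ i, ∑ j, C (LaurentPolynomial.C (A i j) * T (-1)) * (X i * X j) := by
  simp [quadPoly, quadOverMu]

theorem quadPoly_isHomogeneous (A : Matrix (Fin (n + 1)) (Fin (n + 1)) ℂ) :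
    (quadPoly A).IsHomogeneous 2 := (quadOverMu A 2).2

/-- Second derivatives of a quadratic form are homogeneous of degree 0, hence constants; `G` is the
Hessian. -/
theorem exists_pderiv_pderiv_quadPoly (A : Matrix (Fin (n + 1)) (Fin (n + 1)) ℂ) :
    ∃ G : Fin (n + 1) → Fin (n + 1) → R, ∀ a b, pderiv a (pderiv b (quadPoly A)) = C (G a b) :=
  ⟨fun a b => coeff 0 (pderiv a (pderiv b (quadPoly A))), fun _ _ =>
    totalDegree_eq_zero_iff_eq_C.mp
      (Nat.le_zero.mp ((quadPoly_isHomogeneous A).pderiv.pderiv).totalDegree_le)⟩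

theorem star_quadPoly (Λ : Poisson n) (τ : ℂ) (A : Matrix (Fin (n + 1)) (Fin (n + 1)) ℂ) (g : P) :
    star (Λ.scale τ) (quadPoly A) g = quadPoly A * g +
      C (LaurentPolynomial.C (τ / 2) * T 1) * bidiff Λ.lift 1 (quadPoly A) g +
      C (LaurentPolynomial.C (τ ^ 2 / 8) * T 2) * bidiff Λ.lift 2 (quadPoly A) g := by
  have h1 : 1 / 2 * τ = τ / 2 := by ring
  have h2 : (2 : ℂ)⁻¹ * (1 / 2) ^ 2 * τ ^ 2 = τ ^ 2 / 8 := by ring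
  rw [star_scale Λ τ (quadPoly_isHomogeneous A), Finset.sum_range_succ, Finset.sum_range_succ,
    Finset.sum_range_one, bidiff_zero_order]
  simp only [Nat.factorial, Nat.cast_one, Nat.cast_ofNat, inv_one, one_mul, pow_zero, pow_one,
    Nat.cast_zero, LaurentPolynomial.T_zero, map_one, mul_one, h1, h2, zero_add, Nat.succ_eq_add_one,
    Nat.reduceAdd]

theorem star_quadPoly_one (Λ : Poisson n) (τ : ℂ) (A : Matrix (Fin (n + 1)) (Fin (n + 1)) ℂ) :
    star (Λ.scale τ) (quadPoly A) 1 = quadPoly A := by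
  rw [star_quadPoly, bidiff_one, bidiff_two]
  simp

theorem starMul_apply (Λ : Poisson n) (F G : FormalSum n) (d : ℕ) :
    (starMul Λ F G d).1 =
      ∑ p ∈ Finset.HasAntidiagonal.antidiagonal d, star Λ (F p.1).1 (G p.2).1 := rfl

theorem starMul_quadOverMu_add_two (Λ : Poisson n) (A : Matrix (Fin (n + 1)) (Fin (n + 1)) ℂ)
    (G : FormalSum n) (d : ℕ) :
    (starMul Λ (quadOverMu A) G (d + 2)).1 = star Λ (quadPoly A) (G d).1 := by
  rw [starMul_apply]
  rw [Finset.sum_eq_single (2, d)]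
  · rfl
  · rintro ⟨a, b⟩ hp hne
    have ha : a ≠ 2 := by
      rintro rfl
      have := Finset.HasAntidiagonal.mem_antidiagonal.mp hp
      exact hne (Prod.ext rfl (by simp at this ⊢; omega))
    have h0 : quadOverMu A a = 0 := Pi.single_eq_of_ne ha _
    rw [h0]
    exact star_zero_left _ _
  · intro h
    exact absurd (Finset.HasAntidiagonal.mem_antidiagonal.mpr (add_comm _ _)) h

theorem starMul_quadOverMu_of_lt (Λ : Poisson n) (A : Matrix (Fin (n + 1)) (Fin (n + 1)) ℂ)
    (G : FormalSum n) {d : ℕ} (hd : d < 2) : (starMul Λ (quadOverMu A) G d).1 = 0 := by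
  rw [starMul_apply]
  refine Finset.sum_eq_zero ?_
  rintro ⟨a, b⟩ hp
  have ha : a ≠ 2 := by
    have := Finset.HasAntidiagonal.mem_antidiagonal.mp hp
    simp at this
    omega
  have h0 : quadOverMu A a = 0 := Pi.single_eq_of_ne ha _
  rw [h0]
  exact star_zero_left _ _

/-- The star powers of a quadratic form Poisson commute with it, and do not depend on the sign of
the Poisson structure. -/
theorem starPow_scale_neg {Λ : Poisson n} (hΛ : Λ.NormalOrdering) (τ : ℂ)
    (A : Matrix (Fin (n + 1)) (Fin (n + 1)) ℂ) (m d : ℕ) :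
    starPow (Λ.scale (-τ)) (quadOverMu A) m d = starPow (Λ.scale τ) (quadOverMu A) m d ∧
      bidiff Λ.lift 1 (quadPoly A) (starPow (Λ.scale τ) (quadOverMu A) m d).1 = 0 := by
  obtain ⟨G, hG⟩ := exists_pderiv_pderiv_quadPoly A
  induction m generalizing d with
  | zero =>
    refine ⟨rfl, ?_⟩
    change bidiff Λ.lift 1 (quadPoly A) (oneSum n d).1 = 0
    rcases eq_or_ne d 0 with rfl | hd
    · rw [oneSum, Pi.single_eq_same, bidiff_one]
      simp
    · rw [oneSum, Pi.single_eq_of_ne hd]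
      exact bidiff_zero_right _ _ _
  | succ m ih =>
    have hs : ∀ σ, starPow (Λ.scale σ) (quadOverMu A) (m + 1) =
      starMul (Λ.scale σ) (quadOverMu A) (starPow (Λ.scale σ) (quadOverMu A) m) := fun _ => rfl
    rw [hs, hs]
    rcases Nat.lt_or_ge d 2 with hd | hd
    · have h0 := fun Λ G => starMul_quadOverMu_of_lt Λ A G hd
      exact ⟨Subtype.ext (by rw [h0, h0]), by rw [h0, bidiff_zero_right]⟩
    · obtain ⟨e, rfl⟩ := Nat.exists_eq_add_of_le' hd
      obtain ⟨ih1, ih2⟩ := ih e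
      refine ⟨Subtype.ext ?_, ?_⟩
      -- The only term odd in `τ` is the bracket with the previous power, which vanishes by
      -- induction.
      · rw [starMul_quadOverMu_add_two, starMul_quadOverMu_add_two, ih1, star_quadPoly,
          star_quadPoly, ih2, neg_sq, mul_zero, mul_zero]
      · rw [starMul_quadOverMu_add_two, star_quadPoly, ih2, mul_zero, add_zero]
        have hL := hΛ.lift_coordInvariant
        have hC : ∀ r v, bidiff Λ.lift 1 (quadPoly A) (C r * v) =
            C r * bidiff Λ.lift 1 (quadPoly A) v := by
          intro r v
          rw [bidiff_one_mul, bidiff_one_eq]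
          simp
        have hadd : ∀ u v, bidiff Λ.lift 1 (quadPoly A) (u + v) =
            bidiff Λ.lift 1 (quadPoly A) u + bidiff Λ.lift 1 (quadPoly A) v := by
          intro u v
          simp only [bidiff_one_eq, map_add, mul_add, Finset.sum_add_distrib]
        -- The bracket with `quadPoly A` is a derivation that kills `quadPoly A` itself and passes
        -- through the second order part, so it reaches the previous power in every term.
        rw [hadd, bidiff_one_mul, hC, bidiff_one_self Λ.lift_skew, ih2,
          hL.bidiff_one_bidiff_two Λ.lift_skew hG, ih2, bidiff_zero_right]
        ring

theorem starExp_scale_neg {Λ : Poisson n} (hΛ : Λ.NormalOrdering) (τ : ℂ)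
    (A : Matrix (Fin (n + 1)) (Fin (n + 1)) ℂ) :
    starExp (Λ.scale (-τ)) A = starExp (Λ.scale τ) A := by
  funext d
  refine Finset.sum_congr rfl fun m _ => ?_
  rw [(starPow_scale_neg hΛ τ A m d).1]

/-! ### Star exponentials in low degree -/

theorem starPow_eq_zero (Λ : Poisson n) (A : Matrix (Fin (n + 1)) (Fin (n + 1)) ℂ) (m d : ℕ)
    (h : d ≠ 2 * m) : (starPow Λ (quadOverMu A) m d).1 = 0 := by
  induction m generalizing d with
  | zero =>
    change (oneSum n d).1 = 0
    rw [oneSum, Pi.single_eq_of_ne (by simpa using h)]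
    rfl
  | succ m ih =>
    change (starMul _ _ _ d).1 = 0
    rcases Nat.lt_or_ge d 2 with hd | hd
    · exact starMul_quadOverMu_of_lt _ _ _ hd
    · obtain ⟨e, rfl⟩ := Nat.exists_eq_add_of_le' hd
      rw [starMul_quadOverMu_add_two, ih e (by omega), star_zero_right]

theorem starExp_eq (Λ : Poisson n) (A : Matrix (Fin (n + 1)) (Fin (n + 1)) ℂ) (d : ℕ) :
    (starExp Λ A d).1 = ∑ m ∈ Finset.range (d + 1),
      C (LaurentPolynomial.C ((m.factorial : ℂ)⁻¹)) * (starPow Λ (quadOverMu A) m d).1 := by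
  rw [starExp, ← Submodule.subtype_apply, map_sum]
  refine Finset.sum_congr rfl fun m _ => ?_
  rw [map_smul, Submodule.subtype_apply, MvPolynomial.smul_eq_C_mul]

theorem starExp_two_mul (Λ : Poisson n) (A : Matrix (Fin (n + 1)) (Fin (n + 1)) ℂ) (m : ℕ) :
    (starExp Λ A (2 * m)).1 =
      C (LaurentPolynomial.C ((m.factorial : ℂ)⁻¹)) * (starPow Λ (quadOverMu A) m (2 * m)).1 := by
  rw [starExp_eq]
  refine Finset.sum_eq_single m (fun k _ hk => ?_) (fun h => absurd ?_ h)
  · rw [starPow_eq_zero _ _ _ _ (by omega), mul_zero]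
  · rw [Finset.mem_range]
    omega

theorem starExp_odd (Λ : Poisson n) (A : Matrix (Fin (n + 1)) (Fin (n + 1)) ℂ) (m : ℕ) :
    (starExp Λ A (2 * m + 1)).1 = 0 := by
  rw [starExp_eq]
  refine Finset.sum_eq_zero fun k _ => ?_
  rw [starPow_eq_zero _ _ _ _ (by omega), mul_zero]

theorem starExp_degree_zero (Λ : Poisson n) (A : Matrix (Fin (n + 1)) (Fin (n + 1)) ℂ) :
    (starExp Λ A 0).1 = 1 := by
  have h : (starPow Λ (quadOverMu A) 0 0).1 = 1 := by
    change (oneSum n 0).1 = 1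
    rw [oneSum, Pi.single_eq_same]
  have h2 := starExp_two_mul Λ A 0
  rw [mul_zero] at h2
  rw [h2, h]
  simp

theorem starExp_degree_two (Λ : Poisson n) (τ : ℂ) (A : Matrix (Fin (n + 1)) (Fin (n + 1)) ℂ) :
    (starExp (Λ.scale τ) A 2).1 = quadPoly A := by
  have h : (starPow (Λ.scale τ) (quadOverMu A) 1 2).1 = quadPoly A := by
    refine (starMul_quadOverMu_add_two _ _ _ 0).trans ?_
    change star _ _ (oneSum n 0).1 = _
    rw [oneSum, Pi.single_eq_same, star_quadPoly_one]
  have h2 := starExp_two_mul (Λ.scale τ) A 1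
  rw [mul_one] at h2
  rw [h2, h]
  simp

theorem starExp_degree_four (Λ : Poisson n) (τ : ℂ) (A : Matrix (Fin (n + 1)) (Fin (n + 1)) ℂ) :
    (starExp (Λ.scale τ) A 4).1 =
      C (LaurentPolynomial.C (1 / 2)) * star (Λ.scale τ) (quadPoly A) (quadPoly A) := by
  have h : (starPow (Λ.scale τ) (quadOverMu A) 2 4).1 =
      star (Λ.scale τ) (quadPoly A) (quadPoly A) := by
    refine (starMul_quadOverMu_add_two _ _ _ 2).trans ?_
    congr 1
    refine (starMul_quadOverMu_add_two _ _ _ 0).trans ?_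
    change star _ _ (oneSum n 0).1 = _
    rw [oneSum, Pi.single_eq_same, star_quadPoly_one]
  have h2 := starExp_two_mul (Λ.scale τ) A 2
  norm_num at h2
  rw [h2, h]

theorem starMul_starExp_degree_four (Λ : Poisson n) (τ : ℂ)
    (A B : Matrix (Fin (n + 1)) (Fin (n + 1)) ℂ) :
    (starMul (Λ.scale τ) (starExp (Λ.scale τ) A) (starExp (Λ.scale τ) B) 4).1 =
      C (LaurentPolynomial.C (1 / 2)) * star (Λ.scale τ) (quadPoly B) (quadPoly B) +
      star (Λ.scale τ) (quadPoly A) (quadPoly B) +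
      C (LaurentPolynomial.C (1 / 2)) * star (Λ.scale τ) (quadPoly A) (quadPoly A) := by
  have h1 : ∀ A : Matrix (Fin (n + 1)) (Fin (n + 1)) ℂ, (starExp (Λ.scale τ) A 1).1 = 0 :=
    fun A => starExp_odd _ A 0
  have h4 := starExp_degree_four Λ τ A
  have hone : ∀ f : P, f.IsHomogeneous 4 → star (Λ.scale τ) f 1 = f := by
    intro f hf
    rw [star_scale Λ τ hf, Finset.sum_eq_single 0]
    · simp [bidiff_zero_order]
    · intro k _ hk
      have hb : bidiff Λ.lift k f 1 = 0 :=
        Finset.sum_eq_zero fun α _ => Finset.sum_eq_zero fun β _ => by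
          rw [(iterPderiv_isHomogeneous β (isHomogeneous_one _ _)).2 (Nat.pos_of_ne_zero hk),
            mul_zero]
      rw [hb, mul_zero]
    · simp
  rw [starMul_apply]
  rw [Finset.Nat.sum_antidiagonal_eq_sum_range_succ_mk]
  -- Only the bidegrees (0,4), (2,2) and (4,0) survive, since odd components vanish; in the outer
  -- two one factor is the unit.
  simp only [Finset.sum_range_succ, Finset.sum_range_zero, Nat.reduceSub, Nat.sub_zero,
    starExp_degree_zero, starExp_degree_two, h1, star_zero_left, star_zero_right,
    star_one_left, hone _ (starExp (Λ.scale τ) A 4).2]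
  rw [starExp_degree_four, starExp_degree_four]
  ring

/-! ### Diagonal quadratic forms -/

theorem pderiv_quadPoly_diagonal (v : Fin (n + 1) → ℂ) (a : Fin (n + 1)) :
    pderiv a (quadPoly (Matrix.diagonal v)) =
      C (T (-1)) * map LaurentPolynomial.C (C (2 * v a) * X a) := by
  rw [quadPoly_eq, map_sum, Finset.sum_eq_single a]
  · rw [map_sum, Finset.sum_eq_single a]
    · rw [Matrix.diagonal_apply_eq, pderiv_C_mul, Derivation.leibniz, pderiv_X_self]
      simp only [smul_eq_mul, map_mul, map_X, map_C, map_ofNat]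
      ring
    · intro b _ hb
      simp [Matrix.diagonal_apply_ne _ hb.symm]
    · simp
  · intro b _ hb
    rw [map_sum]
    refine Finset.sum_eq_zero fun c _ => ?_
    rcases eq_or_ne b c with rfl | hc
    · simp [Derivation.leibniz, pderiv_X_of_ne hb]
    · simp [Matrix.diagonal_apply_ne _ hc]
  · simp

theorem pderiv_pderiv_quadPoly_diagonal (v : Fin (n + 1) → ℂ) (a b : Fin (n + 1)) :
    pderiv a (pderiv b (quadPoly (Matrix.diagonal v))) =
      if a = b then C (T (-1)) * map LaurentPolynomial.C (C (2 * v a)) else 0 := by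
  rw [pderiv_quadPoly_diagonal, pderiv_C_mul, pderiv_map, pderiv_C_mul]
  split_ifs with h
  · subst h
    rw [pderiv_X_self, mul_one]
  · rw [pderiv_X_of_ne (Ne.symm h)]
    simp

/-- The Poisson bracket of two diagonal quadratic forms. -/
def diagBracket (Λ : Poisson n) (v w : Fin (n + 1) → ℂ) : MvPolynomial (Fin (n + 1)) ℂ :=
  ∑ a, ∑ b, C (4 * v a * w b) * (Λ.coeff a b * X a * X b)

/-- The second order bidifferential expression of two diagonal quadratic forms. -/
def diagSecond (Λ : Poisson n) (v w : Fin (n + 1) → ℂ) : MvPolynomial (Fin (n + 1)) ℂ :=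
  ∑ a, ∑ b, C (4 * v a * w b) * Λ.coeff a b ^ 2

theorem C_T_neg_two : (C (T (-2)) : P) = C (T (-1)) * C (T (-1)) := by
  rw [← C_mul, ← LaurentPolynomial.T_add]
  norm_num

theorem bidiff_one_diagonal (Λ : Poisson n) (v w : Fin (n + 1) → ℂ) :
    bidiff Λ.lift 1 (quadPoly (Matrix.diagonal v)) (quadPoly (Matrix.diagonal w)) =
      C (T (-2)) * map LaurentPolynomial.C (diagBracket Λ v w) := by
  rw [bidiff_one, diagBracket, map_sum, Finset.mul_sum]
  refine Finset.sum_congr rfl fun a _ => ?_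
  rw [map_sum, Finset.mul_sum]
  refine Finset.sum_congr rfl fun b _ => ?_
  rw [pderiv_quadPoly_diagonal, pderiv_quadPoly_diagonal, C_T_neg_two, Poisson.lift]
  simp only [map_mul, map_ofNat]
  ring

theorem bidiff_two_diagonal (Λ : Poisson n) (v w : Fin (n + 1) → ℂ) :
    bidiff Λ.lift 2 (quadPoly (Matrix.diagonal v)) (quadPoly (Matrix.diagonal w)) =
      C (T (-2)) * map LaurentPolynomial.C (diagSecond Λ v w) := by
  rw [bidiff_two, diagSecond, map_sum, Finset.mul_sum]
  refine Finset.sum_congr rfl fun a _ => ?_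
  simp only [pderiv_pderiv_quadPoly_diagonal, mul_ite, ite_mul, mul_zero, zero_mul,
    Finset.sum_ite_eq, Finset.mem_univ, if_true, Finset.sum_ite_irrel, Finset.sum_const_zero]
  rw [map_sum, Finset.mul_sum]
  refine Finset.sum_congr rfl fun b _ => ?_
  rw [C_T_neg_two, Poisson.lift]
  simp only [map_mul, map_ofNat, map_pow]
  ring

/-- The two factors contribute $\mu^{-2}$ and the order $k$ term contributes $\mu^k$, so the
contributions linear and quadratic in $\tau$ sit at different powers of $\mu$. -/
theorem star_diagonal (Λ : Poisson n) (τ : ℂ) (v w : Fin (n + 1) → ℂ) :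
    star (Λ.scale τ) (quadPoly (Matrix.diagonal v)) (quadPoly (Matrix.diagonal w)) =
      quadPoly (Matrix.diagonal v) * quadPoly (Matrix.diagonal w) +
      C (T (-1)) * map LaurentPolynomial.C (C (τ / 2) * diagBracket Λ v w) +
      map LaurentPolynomial.C (C (τ ^ 2 / 8) * diagSecond Λ v w) := by
  have h1 : (C (T (-1)) : P) = C (T 1) * C (T (-2)) := by
    rw [← C_mul, ← LaurentPolynomial.T_add]
    norm_num
  have h2 : (C (T 2) : P) * C (T (-2)) = 1 := by
    rw [← C_mul, ← LaurentPolynomial.T_add]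
    norm_num
  rw [star_quadPoly, bidiff_one_diagonal, bidiff_two_diagonal, h1]
  simp only [map_mul, map_C]
  linear_combination (C (LaurentPolynomial.C (τ ^ 2 / 8)) *
    map LaurentPolynomial.C (diagSecond Λ v w)) * h2

/-- Different powers of `μ` are independent over `ℂ[Z]`. -/
theorem eq_zero_of_T_mul_map_add_map {U W : MvPolynomial (Fin (n + 1)) ℂ}
    (h : (C (T (-1)) * map LaurentPolynomial.C U + map LaurentPolynomial.C W : P) = 0) :
    U = 0 ∧ W = 0 := by
  have key : ∀ (s : Fin (n + 1) →₀ ℕ) (m : ℤ), (if -1 = m then coeff s U else 0) +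
      (if 0 = m then coeff s W else 0) = 0 := by
    intro s m
    have h1 := congrArg (fun p : P => (coeff s p).coeff m) h
    simp only [coeff_add, coeff_C_mul, coeff_map, coeff_zero] at h1
    rw [mul_comm, ← LaurentPolynomial.single_eq_C_mul_T, ← LaurentPolynomial.single_eq_C] at h1
    simpa only [AddMonoidAlgebra.coeff_add, AddMonoidAlgebra.coeff_single, Finsupp.add_apply,
      Finsupp.single_apply, AddMonoidAlgebra.coeff_zero, Finsupp.zero_apply] using h1
  constructor
  · ext s
    simpa using key s (-1)
  · ext s
    simpa using key s 0

theorem Poisson.coeff_self (Λ : Poisson n) (a : Fin (n + 1)) : Λ.coeff a a = 0 :=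
  CharZero.eq_neg_self_iff.mp (Λ.skew a a)

theorem diagBracket_single (Λ : Poisson n) (i j : Fin (n + 1)) :
    diagBracket Λ (Pi.single i 1) (Pi.single j 1) = C 4 * (Λ.coeff i j * X i * X j) := by
  rw [diagBracket, Finset.sum_eq_single i, Finset.sum_eq_single j]
  · simp
  · intro b _ hb
    simp [Pi.single_eq_of_ne hb]
  · simp
  · intro a _ ha
    simp [Pi.single_eq_of_ne ha]
  · simp

theorem diagSecond_single (Λ : Poisson n) (i j : Fin (n + 1)) :
    diagSecond Λ (Pi.single i 1) (Pi.single j 1) = C 4 * Λ.coeff i j ^ 2 := by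
  rw [diagSecond, Finset.sum_eq_single i, Finset.sum_eq_single j]
  · simp
  · intro b _ hb
    simp [Pi.single_eq_of_ne hb]
  · simp
  · intro a _ ha
    simp [Pi.single_eq_of_ne ha]
  · simp

/-- The diagonal contributions vanish by skew-symmetry, while the two cross terms add up because
squaring removes the sign of $\Lambda^{ji}=-\Lambda^{ij}$. -/
theorem diagSecond_single_add_single (Λ : Poisson n) (i j : Fin (n + 1)) :
    diagSecond Λ (Pi.single i 1 + Pi.single j 1) (Pi.single i 1 + Pi.single j 1) =
      C 8 * Λ.coeff i j ^ 2 := by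
  have h : diagSecond Λ (Pi.single i 1 + Pi.single j 1) (Pi.single i 1 + Pi.single j 1) =
      diagSecond Λ (Pi.single i 1) (Pi.single i 1) + diagSecond Λ (Pi.single i 1) (Pi.single j 1) +
      (diagSecond Λ (Pi.single j 1) (Pi.single i 1) +
        diagSecond Λ (Pi.single j 1) (Pi.single j 1)) := by
    simp only [diagSecond, ← Finset.sum_add_distrib]
    refine Finset.sum_congr rfl fun a _ => Finset.sum_congr rfl fun b _ => ?_
    simp only [Pi.add_apply, map_mul, map_add]
    ring
  have h8 : (C 8 : MvPolynomial (Fin (n + 1)) ℂ) = C 4 + C 4 := by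
    rw [← C_add]
    norm_num
  simp only [h, diagSecond_single, Λ.coeff_self, Λ.skew i j, h8]
  ring

end Star

end StarCP

end

/-! ### Detection of `τ` in degree four, and invariance under its sign. -/

theorem mainTheorem5 (n : ℕ) (Λ : StarCP.Poisson n) (hΛ : Λ.NormalOrdering)
    (hΛ0 : Λ.coeff ≠ 0) :
    (∃ A B : Matrix (Fin (n + 1)) (Fin (n + 1)) ℂ, A.IsSymm ∧ B.IsSymm ∧
      ∀ τ τ' : ℂ, τ ≠ τ' →
        StarCP.cohomologyClass (StarCP.starMul (Λ.scale τ)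
            (StarCP.starExp (Λ.scale τ) A) (StarCP.starExp (Λ.scale τ) B)) ≠
          StarCP.cohomologyClass (StarCP.starMul (Λ.scale τ')
            (StarCP.starExp (Λ.scale τ') A) (StarCP.starExp (Λ.scale τ') B))) ∧
    (∃ A : Matrix (Fin (n + 1)) (Fin (n + 1)) ℂ, A.IsSymm ∧
      ∀ τ τ' : ℂ, τ ≠ τ' → τ ≠ -τ' →
        StarCP.cohomologyClass (StarCP.starExp (Λ.scale τ) A) ≠
          StarCP.cohomologyClass (StarCP.starExp (Λ.scale τ') A)) ∧
    (∀ A : Matrix (Fin (n + 1)) (Fin (n + 1)) ℂ, A.IsSymm → ∀ τ : ℂ,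
      StarCP.cohomologyClass (StarCP.starExp (Λ.scale (-τ)) A) =
        StarCP.cohomologyClass (StarCP.starExp (Λ.scale τ) A)) := by
  obtain ⟨i, j, hij⟩ : ∃ i j, Λ.coeff i j ≠ 0 := by
    by_contra! h
    exact hΛ0 (funext fun i => funext fun j => h i j)
  refine ⟨⟨Matrix.diagonal (Pi.single i 1), Matrix.diagonal (Pi.single j 1),
    Matrix.isSymm_diagonal _, Matrix.isSymm_diagonal _, fun τ τ' hτ h => ?_⟩,
    ⟨Matrix.diagonal (Pi.single i 1 + Pi.single j 1), Matrix.isSymm_diagonal _,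
      fun τ τ' hτ hτ' h => ?_⟩, fun A _ τ => ?_⟩
  · have h4 := congrArg Subtype.val (congrFun (StarCP.cohomologyClass_injective h) 4)
    simp only [StarCP.starMul_starExp_degree_four, StarCP.star_diagonal,
      StarCP.diagBracket_single, StarCP.diagSecond_single, Λ.coeff_self] at h4
    -- `U` and `W` are the $\mu^{-1}$ and $\mu^0$ parts of the difference of the degree 4
    -- components. The squares of the single forms contribute nothing to it, since
    -- $\Lambda^{ii}=\Lambda^{jj}=0$, and the $\tau$-free products cancel.
    have h5 := StarCP.eq_zero_of_T_mul_map_add_map (n := n)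
      (U := MvPolynomial.C ((τ - τ') / 2) *
        (MvPolynomial.C 4 * (Λ.coeff i j * MvPolynomial.X i * MvPolynomial.X j)))
      (W := MvPolynomial.C ((τ ^ 2 - τ' ^ 2) / 8) * (MvPolynomial.C 4 * Λ.coeff i j ^ 2)) (by
        simp only [sub_div, map_sub, map_mul, MvPolynomial.map_C] at h4 ⊢
        simp only [zero_mul, mul_zero, map_zero, add_zero, ne_eq, OfNat.ofNat_ne_zero,
          not_false_eq_true, zero_pow] at h4
        linear_combination h4)
    simp [sub_ne_zero.mpr hτ, hij] at h5
  · have h4 := congrArg Subtype.val (congrFun (StarCP.cohomologyClass_injective h) 4)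
    simp only [StarCP.starExp_degree_four, StarCP.star_diagonal,
      StarCP.diagSecond_single_add_single] at h4
    set v : Fin (n + 1) → ℂ := Pi.single i 1 + Pi.single j 1
    -- Only the vanishing of `W` is needed: it forces $\tau^2=\tau'^2$, so the self-bracket in `U`
    -- need not be evaluated.
    have h5 := StarCP.eq_zero_of_T_mul_map_add_map (n := n)
      (U := MvPolynomial.C (1 / 2 * ((τ - τ') / 2)) * StarCP.diagBracket Λ v v)
      (W := MvPolynomial.C (1 / 2 * ((τ ^ 2 - τ' ^ 2) / 8)) *
        (MvPolynomial.C 8 * Λ.coeff i j ^ 2)) (by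
        simp only [sub_div, map_sub, map_mul, MvPolynomial.map_C] at h4 ⊢
        linear_combination h4)
    have h6 : τ ^ 2 - τ' ^ 2 ≠ 0 := by
      rw [sq_sub_sq]
      exact mul_ne_zero (fun h0 => hτ' (eq_neg_of_add_eq_zero_left h0)) (sub_ne_zero.mpr hτ)
    have h7 := h5.2
    simp [h6, hij] at h7
  · rw [StarCP.starExp_scale_neg hΛ]
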